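/- For an integer $n\ge 1$ let $[n]=\{1,\dots,n\}$. Let $\mathcal{EC}^d(n)$ be the graph with vertex set $[n]^d$ in which $x$ and $y$ are adjacent if and only if their Euclidean distance is $1$. Let $\mathcal{BEC}^d(n,t)$ be its $t$-fold blow-up, i.e. the graph with vertex set $[n]^d\times[t]$ in which two distinct vertices $(x,i)$ and $(y,j)$ are adjacent if and only if $x=y$ or $x$ and $y$ are adjacent in $\mathcal{EC}^d(n)$. **Theorem (Blown-up Cube Wiring).** For every integer $d\ge 3$ there is a positive integer $c$, depending only on $d$, such that for all positive integers $n,t$ the following holds. Let $$P=\big([n]^{d-1}\times\{1\}\big)\times[t],\qquad Q=\big([n]^{d-1}\times\{cn\}\big)\times[t],$$ which are sets of vertices in two opposite facets of $\mathcal{BEC}^d(cn,t)$. Then for every (not necessarily perfect) matching $M$ between $P$ and $Q$ there is a family of pairwise vertex-disjoint paths in $\mathcal{BEC}^d(cn,t)$ that contains, for each $pq\in M$ with $p\in P$ and $q\in Q$, a path connecting $p$ and $q$. -/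

import Mathlib

/-- The integer segment `[n] = {1, …, n}`, as a type. -/
abbrev Seg (n : ℕ) : Type := Set.Icc (1 : ℕ) n

/-- A point of `[n]^d` seen as a point of Euclidean space `ℝ^d`. -/
def gridPoint {d n : ℕ} (x : Fin d → Seg n) : EuclideanSpace ℝ (Fin d) :=
  WithLp.toLp 2 (fun k => ((x k : ℕ) : ℝ))

/-- The `d`-dimensional Euclidean grid graph on `[n]^d`: two vertices are adjacent if and only if
their Euclidean distance is `1`. -/
def euclideanCube (d n : ℕ) : SimpleGraph (Fin d → Seg n) where
  Adj x y := dist (gridPoint x) (gridPoint y) = 1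
  symm := ⟨fun x y h => by rw [dist_comm]; exact h⟩
  loopless := ⟨fun x h => by simp at h⟩

/-- The `t`-fold blow-up of the Euclidean grid graph, on `[n]^d × [t]`: distinct vertices `(x, i)`
and `(y, j)` are adjacent if and only if `x = y` or `x` and `y` are adjacent in the grid graph. -/
def blownUpCube (d n t : ℕ) : SimpleGraph ((Fin d → Seg n) × Seg t) where
  Adj v w := v ≠ w ∧ (v.1 = w.1 ∨ (euclideanCube d n).Adj v.1 w.1)
  symm := ⟨fun _ _ h => ⟨h.1.symm, h.2.imp Eq.symm (fun e => e.symm)⟩⟩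
  loopless := ⟨fun _ h => h.1 rfl⟩

/-- The set `([n]^(d-1) × {h}) × [t]` of vertices of the blow-up of the grid graph on `[m]^d`:
the first `d - 1` coordinates are at most `n` and the last one equals `h`. -/
def blownUpLayer (d m t n h : ℕ) : Set ((Fin d → Seg m) × Seg t) :=
  {v | ∀ k : Fin d,
    ((k : ℕ) + 1 < d → (v.1 k : ℕ) ≤ n) ∧ ((k : ℕ) + 1 = d → (v.1 k : ℕ) = h)}

/-- A graph `M` all of whose edges run between `P` and `Q` can be embedded in `G`: there is a
family of paths of `G`, one from `p` to `q` for every edge `pq` of `M` with `p ∈ P` and `q ∈ Q`,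
such that the paths of distinct edges have no vertex in common. -/
def EmbedsByDisjointPaths {V : Type*} (G : SimpleGraph V) (P Q : Set V)
    (M : ((⊤ : SimpleGraph V).between P Q).Subgraph) : Prop :=
  ∃ path : (e : {e : V × V // e.1 ∈ P ∧ e.2 ∈ Q ∧ M.Adj e.1 e.2}) → G.Path e.1.1 e.1.2,
    Pairwise fun e e' => List.Disjoint (path e).1.support (path e').1.support

/-!
The last coordinate is regarded as a height, and `m = d - 1` is the number of the other ones. If the
labels are forgotten, `M` is a bipartite multigraph between two copies of `[n]^m` with at most `t`
edges at each vertex. König's theorem (`exists_edge_coloring`, proved by completing the multigraph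
to a regular one and splitting off perfect matchings with Hall's theorem) colours its edges with `t`
colours, so that each colour is a partial injection of `[n]^m`. If the walks of each colour are
disjoint in the grid, the blow-up has room for all colours at once: a path uses its colour as label
at all heights strictly between the bottom and the top layer, and the bottom and top layers contain
nothing but the ends of the paths, with their prescribed labels.

It remains to route one partial injection of `[n]^m` by disjoint walks in a slab of height `O(n)`,
see `routable_of_injective`. Routings can be stacked and reversed, so it is enough to compose simple
ones.

* All coordinates are tripled, one after the other, in a slab of height `n + 1` for each coordinate
  (`routable_spread`); at the end this is undone.
* Spread-out points can be permuted along the lines of one direction `k` in a slab of height `n + 1`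
  (`routable_line`): since `m ≥ 2` there is another direction `l`, and the lines have distance three
  in that direction, which leaves room for two further layers. The path of a point with `k`-th
  coordinate `v` makes its horizontal move at height `v`, in a layer reserved for such moves; one
  layer is reserved for the rising paths that have not moved yet, and one for those that have.
* Any partial injection of `[n]^m` is a composition of such permutations along lines
  (`routable_spread_univ`), by the same colouring theorem: the points are first distributed along
  direction `k` so that those with the same `k`-th coordinate differ in the other coordinates both
  at their start and at their destination, then induction handles the other directions, and
  finally the `k`-th coordinate is corrected.
-/

/-! ### Edge colourings of bipartite multigraphs -/

/-- A regular bipartite multigraph of positive degree, with edge set `s` and end maps `f` and `g`,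
has a perfect matching; `e x` is its edge at the vertex `x` of the first side. -/
theorem exists_perfect_matching_of_regular {E X : Type*} [Fintype X] [DecidableEq X]
    [DecidableEq E] (f g : E → X) (t : ℕ) (s : Finset E)
    (hf : ∀ x, (s.filter (f · = x)).card = t + 1) (hg : ∀ x, (s.filter (g · = x)).card = t + 1) :
    ∃ e : X → E, (∀ x, e x ∈ s) ∧ (∀ x, f (e x) = x) ∧ Function.Injective fun x => g (e x) := by
  have hall : ∀ A : Finset X, A.card ≤ (A.biUnion fun x => (s.filter (f · = x)).image g).card := by
    intro A
    set N := A.biUnion fun x => (s.filter (f · = x)).image g with hN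
    have h1 : (s.filter (f · ∈ A)).card = A.card * (t + 1) := by
      rw [Finset.card_eq_sum_card_fiberwise (f := f) (t := A) (by intro e he; simp at he; simp [he])]
      rw [Finset.sum_const_nat (m := t + 1)]
      intro x hx
      rw [← hf x]
      congr 1
      ext e
      simp only [Finset.mem_filter]
      constructor
      · rintro ⟨⟨h, -⟩, h'⟩
        exact ⟨h, h'⟩
      · rintro ⟨h, rfl⟩
        exact ⟨⟨h, hx⟩, rfl⟩
    have h2 : (s.filter (g · ∈ N)).card = N.card * (t + 1) := by
      rw [Finset.card_eq_sum_card_fiberwise (f := g) (t := N) (by intro e he; simp at he; simp [he])]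
      rw [Finset.sum_const_nat (m := t + 1)]
      intro x hx
      rw [← hg x]
      congr 1
      ext e
      simp only [Finset.mem_filter]
      constructor
      · rintro ⟨⟨h, -⟩, h'⟩
        exact ⟨h, h'⟩
      · rintro ⟨h, rfl⟩
        exact ⟨⟨h, hx⟩, rfl⟩
    have h3 : s.filter (f · ∈ A) ⊆ s.filter (g · ∈ N) := by
      intro e he
      simp only [Finset.mem_filter] at he ⊢
      refine ⟨he.1, Finset.mem_biUnion.2 ⟨f e, he.2, Finset.mem_image.2 ⟨e, ?_, rfl⟩⟩⟩
      simp [he.1]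
    have h4 := Finset.card_le_card h3
    rw [h1, h2] at h4
    exact Nat.le_of_mul_le_mul_right h4 t.succ_pos
  obtain ⟨F, hFinj, hF⟩ := (Finset.all_card_le_biUnion_card_iff_exists_injective _).1 hall
  have hF' : ∀ x, ∃ e ∈ s, f e = x ∧ g e = F x := by
    intro x
    obtain ⟨e, he, hge⟩ := Finset.mem_image.1 (hF x)
    exact ⟨e, (Finset.mem_filter.1 he).1, (Finset.mem_filter.1 he).2, hge⟩
  choose e hes hef heg using hF'
  exact ⟨e, hes, hef, by simpa only [heg] using hFinj⟩

/-- A `t`-regular bipartite multigraph has a proper edge colouring with `t` colours. -/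
theorem exists_edge_coloring_of_regular {E X : Type*} [Fintype X] (f g : E → X) (t : ℕ)
    [DecidableEq X] (s : Finset E)
    (hf : ∀ x, (s.filter (f · = x)).card = t) (hg : ∀ x, (s.filter (g · = x)).card = t) :
    ∃ κ : E → ℕ, (∀ e ∈ s, κ e < t) ∧ Set.InjOn (fun e => (f e, κ e)) s ∧
      Set.InjOn (fun e => (g e, κ e)) s := by
  classical
  induction t generalizing s with
  | zero =>
    have hs : s = ∅ := by
      refine Finset.eq_empty_of_forall_notMem fun e he => ?_
      have := Finset.card_eq_zero.1 (hf (f e))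
      exact Finset.notMem_empty e (this ▸ Finset.mem_filter.2 ⟨he, rfl⟩)
    subst hs
    exact ⟨fun _ => 0, by simp⟩
  | succ t ih =>
    obtain ⟨e, hes, hef, heg⟩ := exists_perfect_matching_of_regular f g t s hf hg
    have hegb := Finite.injective_iff_bijective.1 heg
    have hcard : ∀ (p : E → X) (e₀ : X → E), (∀ x, p (e₀ x) = x) → (∀ x, e₀ x ∈ s) →
        Set.range e₀ = Set.range e → (∀ x, (s.filter (p · = x)).card = t + 1) →
        ∀ x, ((s \ Finset.univ.image e).filter (p · = x)).card = t := by
      intro p e₀ hp hs hr hc x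
      have : (s \ Finset.univ.image e).filter (p · = x) = (s.filter (p · = x)).erase (e₀ x) := by
        ext y
        have hy : y ∈ Finset.univ.image e ↔ y ∈ Set.range e₀ := by simp [hr]
        simp only [Finset.mem_filter, Finset.mem_sdiff, Finset.mem_erase, hy]
        constructor
        · rintro ⟨⟨h1, h2⟩, h3⟩
          exact ⟨fun h => h2 ⟨x, h.symm⟩, h1, h3⟩
        · rintro ⟨h1, h2, h3⟩
          refine ⟨⟨h2, ?_⟩, h3⟩
          rintro ⟨z, rfl⟩
          rw [hp] at h3
          exact h1 (by rw [h3])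
      rw [this, Finset.card_erase_of_mem (by simp [hs, hp]), hc]
      rfl
    let σ := Equiv.ofBijective _ hegb
    obtain ⟨κ, hκ, hfκ, hgκ⟩ := ih (s \ Finset.univ.image e)
      (hcard f e hef hes rfl hf)
      (hcard g (e ∘ σ.symm) (fun x => σ.apply_symm_apply x) (fun x => hes _)
        (σ.symm.surjective.range_comp e) hg)
    -- The edges of the matching get the new colour `t`.
    refine ⟨fun y => if y ∈ Finset.univ.image e then t else κ y, ?_, ?_, ?_⟩
    · intro y hy
      by_cases h : y ∈ Finset.univ.image e
      · simp [h]
      · have := hκ y (Finset.mem_sdiff.2 ⟨hy, h⟩)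
        simp only [h, if_false]
        omega
    all_goals
      intro y hy z hz hyz
      simp only [Prod.mk.injEq] at hyz
      obtain ⟨h1, h2⟩ := hyz
      by_cases h : y ∈ Finset.univ.image e <;> by_cases h' : z ∈ Finset.univ.image e
      · obtain ⟨y, -, rfl⟩ := Finset.mem_image.1 h
        obtain ⟨z, -, rfl⟩ := Finset.mem_image.1 h'
        first
        | rw [hef, hef] at h1
          rw [h1]
        | rw [heg h1]
      · have := hκ z (Finset.mem_sdiff.2 ⟨hz, h'⟩)
        simp only [h, h', if_true, if_false] at h2
        omega
      · have := hκ y (Finset.mem_sdiff.2 ⟨hy, h⟩)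
        simp only [h, h', if_true, if_false] at h2
        omega
      · simp only [h, h', if_false] at h2
        have hy' : y ∈ s \ Finset.univ.image e := Finset.mem_sdiff.2 ⟨hy, h⟩
        have hz' : z ∈ s \ Finset.univ.image e := Finset.mem_sdiff.2 ⟨hz, h'⟩
        first
        | exact hfκ hy' hz' (Prod.mk.injEq .. ▸ ⟨h1, h2⟩)
        | exact hgκ hy' hz' (Prod.mk.injEq .. ▸ ⟨h1, h2⟩)

/-- König's edge colouring theorem. The multigraph has edge set `ι`, and `a`, `b` place the two
ends of its edges injectively in `X × [t]`, so that no vertex has more than `t` edges. -/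
theorem exists_edge_coloring {ι X : Type*} [Finite X] {t : ℕ} (a b : ι → X × Fin t)
    (ha : Function.Injective a) (hb : Function.Injective b) :
    ∃ κ : ι → Fin t, Function.Injective (fun i => ((a i).1, κ i)) ∧
      Function.Injective (fun i => ((b i).1, κ i)) := by
  classical
  have := Fintype.ofFinite X
  -- Extending `b ∘ a⁻¹` to a permutation of `X × [t]` completes the multigraph to a regular one.
  let σ : Equiv.Perm (X × Fin t) := Equiv.extendSubtype
    ((Equiv.ofInjective a ha).symm.trans (Equiv.ofInjective b hb))
  have hσ : ∀ i, σ (a i) = b i := by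
    intro i
    have := Equiv.extendSubtype_apply_of_mem
      ((Equiv.ofInjective a ha).symm.trans (Equiv.ofInjective b hb)) (a i) ⟨i, rfl⟩
    rw [this]
    simp [Equiv.ofInjective_symm_apply]
  have hf : ∀ x : X, (Finset.univ.filter fun e : X × Fin t => e.1 = x).card = t := by
    intro x
    have : (Finset.univ.filter fun e : X × Fin t => e.1 = x) = {x} ×ˢ Finset.univ := by
      ext e
      simp only [Finset.mem_filter, Finset.mem_univ, true_and, Finset.mem_product,
        Finset.mem_singleton, and_true]
    rw [this]
    simp
  have hg : ∀ x : X, (Finset.univ.filter fun e : X × Fin t => (σ e).1 = x).card = t := by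
    intro x
    refine (Finset.card_equiv σ ?_).trans (hf x)
    simp
  obtain ⟨κ, hκ, h1, h2⟩ := exists_edge_coloring_of_regular
    (fun e : X × Fin t => e.1) (fun e => (σ e).1) t Finset.univ hf hg
  refine ⟨fun i => ⟨κ (a i), hκ _ (Finset.mem_univ _)⟩, fun i j h => ?_, fun i j h => ?_⟩
  · simp only [Prod.mk.injEq, Fin.mk.injEq] at h
    exact ha (h1 (by simp) (by simp) (Prod.ext h.1 h.2))
  · simp only [Prod.mk.injEq, Fin.mk.injEq] at h
    exact ha (h2 (by simp) (by simp) (Prod.ext (by simpa [hσ] using h.1) h.2))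

/-! ### Joining vertices inside a set -/

/-- Some walk of `G` from `u` to `v` stays inside `S`. -/
def WalkWithin {V : Type*} (G : SimpleGraph V) (S : Set V) (u v : V) : Prop :=
  ∃ w : G.Walk u v, ∀ x ∈ w.support, x ∈ S

namespace WalkWithin

variable {V W : Type*} {G : SimpleGraph V} {H : SimpleGraph W} {S T : Set V} {u v w : V}

theorem refl (h : u ∈ S) : WalkWithin G S u u := ⟨.nil, by simpa⟩

theorem symm (h : WalkWithin G S u v) : WalkWithin G S v u := by
  obtain ⟨p, hp⟩ := h
  exact ⟨p.reverse, by simpa⟩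

theorem trans (h : WalkWithin G S u v) (h' : WalkWithin G S v w) : WalkWithin G S u w := by
  obtain ⟨p, hp⟩ := h
  obtain ⟨q, hq⟩ := h'
  exact ⟨p.append q, fun x hx => ((SimpleGraph.Walk.mem_support_append_iff p q).1 hx).elim
    (hp x) (hq x)⟩

theorem of_adj (h : G.Adj u v) (hu : u ∈ S) (hv : v ∈ S) : WalkWithin G S u v :=
  ⟨h.toWalk, by simp [hu, hv]⟩

theorem map {U : Set W} (φ : V → W) (hS : ∀ x ∈ S, φ x ∈ U)
    (hG : ∀ x ∈ S, ∀ y ∈ S, G.Adj x y → H.Adj (φ x) (φ y)) (h : WalkWithin G S u v) :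
    WalkWithin H U (φ u) (φ v) := by
  obtain ⟨p, hp⟩ := h
  induction p with
  | nil => exact refl (hS _ (hp _ (by simp)))
  | cons hadj p ih =>
    simp only [SimpleGraph.Walk.support_cons, List.mem_cons, forall_eq_or_imp] at hp
    have h2 := hp.2 _ p.start_mem_support
    exact (of_adj (hG _ hp.1 _ h2 hadj) (hS _ hp.1) (hS _ h2)).trans (ih hp.2)

theorem mono (hST : S ⊆ T) (h : WalkWithin G S u v) : WalkWithin G T u v :=
  h.map id hST fun _ _ _ _ => id

end WalkWithin

/-- The grid graph on `ℕ^m × ℤ`; the last coordinate is the height. -/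
def slabGrid (m : ℕ) : SimpleGraph ((Fin m → ℕ) × ℤ) where
  Adj u v := (u.1 = v.1 ∧ (u.2 + 1 = v.2 ∨ v.2 + 1 = u.2)) ∨
    (u.2 = v.2 ∧ ∃ k, (∀ j, j ≠ k → u.1 j = v.1 j) ∧
      (u.1 k + 1 = v.1 k ∨ v.1 k + 1 = u.1 k))
  symm := ⟨by
    rintro u v (⟨h, h'⟩ | ⟨h, k, hk, h'⟩)
    · exact .inl ⟨h.symm, h'.symm⟩
    · exact .inr ⟨h.symm, k, fun j hj => (hk j hj).symm, h'.symm⟩⟩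
  loopless := ⟨by
    rintro u (⟨-, h⟩ | ⟨-, k, -, h⟩) <;> omega⟩

theorem walkWithin_vertical {m : ℕ} {S : Set ((Fin m → ℕ) × ℤ)} {y : Fin m → ℕ} {p q : ℤ}
    (hpq : p ≤ q) (h : ∀ z, p ≤ z → z ≤ q → (y, z) ∈ S) :
    WalkWithin (slabGrid m) S (y, p) (y, q) := by
  induction q, hpq using Int.leInduction with
  | base => exact .refl (h p le_rfl le_rfl)
  | succ q hpq ih =>
    refine (ih fun z h1 h2 => h z h1 (by omega)).trans (.of_adj (.inl ⟨rfl, .inl rfl⟩) ?_ ?_)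
    · exact h _ hpq (by omega)
    · exact h _ (by omega) le_rfl

theorem walkWithin_lateral {m : ℕ} {S : Set ((Fin m → ℕ) × ℤ)} {u v : Fin m → ℕ} {z : ℤ}
    (k : Fin m) (huv : ∀ j, j ≠ k → u j = v j)
    (h : ∀ w : Fin m → ℕ, (∀ j, j ≠ k → w j = u j) → min (u k) (v k) ≤ w k →
      w k ≤ max (u k) (v k) → (w, z) ∈ S) :
    WalkWithin (slabGrid m) S (u, z) (v, z) := by
  have key : ∀ p q, p ≤ q → (∀ r, p ≤ r → r ≤ q → (Function.update u k r, z) ∈ S) →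
      WalkWithin (slabGrid m) S (Function.update u k p, z) (Function.update u k q, z) := by
    intro p q hpq
    induction q, hpq using Nat.le_induction with
    | base => exact fun h => .refl (h p le_rfl le_rfl)
    | succ q hpq ih =>
      intro h
      refine (ih fun r h1 h2 => h r h1 (by omega)).trans
        (.of_adj (.inr ⟨rfl, k, fun j hj => by simp [hj], .inl (by simp)⟩) ?_ ?_)
      · exact h _ hpq (by omega)
      · exact h _ (by omega) le_rfl
  have hu : u = Function.update u k (u k) := by simp
  have hv : v = Function.update u k (v k) := by
    ext j
    by_cases hj : j = k
    · subst hj; simp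
    · simp [hj, huv j hj]
  have hS : ∀ r, min (u k) (v k) ≤ r → r ≤ max (u k) (v k) → (Function.update u k r, z) ∈ S :=
    fun r h1 h2 => h _ (fun j hj => by simp [hj]) (by simpa using h1) (by simpa using h2)
  rw [hv, hu]
  simp only [Function.update_idem]
  rcases le_total (u k) (v k) with hle | hle
  · exact key _ _ hle fun r h1 h2 => hS r (by omega) (by omega)
  · exact (key _ _ hle fun r h1 h2 => hS r (by omega) (by omega)).symm

/-! ### Routing problems in a slab -/

/-- In the slab `{0, …, B - 1}^m × {0, …, h - 1}` there are pairwise disjoint sets of vertices, one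
for each `i`, the `i`-th of which contains a walk from the point above `a i` on the bottom to the
point above `b i` on the top. -/
def Routable {ι : Type*} {m : ℕ} (B h : ℕ) (a b : ι → Fin m → ℕ) : Prop :=
  ∃ S : ι → Set ((Fin m → ℕ) × ℤ), Pairwise (fun i j => Disjoint (S i) (S j)) ∧
    (∀ i, ∀ v ∈ S i, (∀ k, v.1 k < B) ∧ 0 ≤ v.2 ∧ v.2 < h) ∧
    ∀ i, WalkWithin (slabGrid m) (S i) (a i, 0) (b i, (h : ℤ) - 1)

namespace Routable

variable {ι : Type*} {m B h h' : ℕ} {a b c : ι → Fin m → ℕ}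

/-- Routings are stacked on top of each other. -/
theorem trans (H : Routable B h a b) (H' : Routable B h' b c) : Routable B (h + h') a c := by
  obtain ⟨S, hS, hb, hj⟩ := H
  obtain ⟨S', hS', hb', hj'⟩ := H'
  refine ⟨fun i => S i ∪ {v | (v.1, v.2 - h) ∈ S' i}, fun i j hij => ?_, ?_, fun i => ?_⟩
  · refine Set.disjoint_left.2 ?_
    rintro ⟨y, z⟩ (hi | hi) (hj | hj)
    · exact Set.disjoint_left.1 (hS hij) hi hj
    · have h1 := (hb i _ hi).2
      have h2 := (hb' j _ hj).2
      simp only at h1 h2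
      omega
    · have h1 := (hb j _ hj).2
      have h2 := (hb' i _ hi).2
      simp only at h1 h2
      omega
    · exact Set.disjoint_left.1 (hS' hij) hi hj
  · rintro i ⟨y, z⟩ (hi | hi)
    · have := hb i _ hi
      refine ⟨this.1, this.2.1, ?_⟩
      have := this.2.2
      push_cast
      omega
    · have h1 := hb' i _ hi
      refine ⟨h1.1, ?_, ?_⟩ <;> have h2 := h1.2 <;> simp only at h2 ⊢ <;> push_cast <;> omega
  · have h1 := (hj i).mono (T := S i ∪ {v | (v.1, v.2 - h) ∈ S' i}) Set.subset_union_left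
    have h2 := (hj' i).map (H := slabGrid m) (U := S i ∪ {v | (v.1, v.2 - h) ∈ S' i})
      (fun v => (v.1, v.2 + h)) (fun v hv => .inr (by simpa using hv)) (by
        rintro ⟨y, z⟩ - ⟨y', z'⟩ - hadj
        simp only [slabGrid] at hadj ⊢
        rcases hadj with hadj | hadj
        · exact .inl ⟨hadj.1, by omega⟩
        · exact .inr ⟨by omega, hadj.2⟩)
    obtain ⟨p, hp⟩ := h1
    obtain ⟨q, hq⟩ := h2
    have hlink : WalkWithin (slabGrid m) (S i ∪ {v | (v.1, v.2 - h) ∈ S' i})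
        (b i, (h : ℤ) - 1) (b i, 0 + h) :=
      .of_adj (.inl ⟨rfl, .inl (by simp)⟩) (hp _ p.end_mem_support) (hq _ q.start_mem_support)
    have := (WalkWithin.trans ⟨p, hp⟩ hlink).trans ⟨q, hq⟩
    convert this using 2
    push_cast
    ring

theorem symm (H : Routable B h a b) : Routable B h b a := by
  obtain ⟨S, hS, hb, hj⟩ := H
  refine ⟨fun i => {v | (v.1, (h : ℤ) - 1 - v.2) ∈ S i}, fun i j hij => ?_, ?_, fun i => ?_⟩
  · refine Set.disjoint_left.2 ?_
    exact fun v hi hj => Set.disjoint_left.1 (hS hij) hi hj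
  · intro i v hv
    have := hb i _ hv
    simp only at this
    exact ⟨this.1, by omega, by omega⟩
  · have h2 := ((hj i).map (H := slabGrid m) (U := {v | (v.1, (h : ℤ) - 1 - v.2) ∈ S i})
      (fun v => (v.1, (h : ℤ) - 1 - v.2)) (fun v hv => by simpa using hv) (by
        rintro ⟨y, z⟩ - ⟨y', z'⟩ - hadj
        simp only [slabGrid] at hadj ⊢
        rcases hadj with hadj | hadj
        · exact .inl ⟨hadj.1, by omega⟩
        · exact .inr ⟨by omega, hadj.2⟩)).symm
    simpa using h2

theorem refl (ha : Function.Injective a) (haB : ∀ i k, a i k < B) (hh : 0 < h) :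
    Routable B h a a := by
  refine ⟨fun i => {v | v.1 = a i ∧ 0 ≤ v.2 ∧ v.2 < h}, fun i j hij => ?_, ?_, fun i => ?_⟩
  · refine Set.disjoint_left.2 ?_
    exact fun v hi hj => hij (ha (hi.1.symm.trans hj.1))
  · rintro i v ⟨h1, h2⟩
    exact ⟨fun k => h1 ▸ haB i k, h2⟩
  · exact walkWithin_vertical (by omega) fun z h1 h2 => ⟨rfl, h1, by simp only; omega⟩

end Routable

/-! ### Spreading out and permuting along lines -/

/-- The point `x`, with its coordinates in `s` multiplied by three. -/
def spread {m n : ℕ} (s : Finset (Fin m)) (x : Fin m → Fin n) : Fin m → ℕ :=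
  fun j => if j ∈ s then 3 * (x j : ℕ) else x j

theorem spread_lt {m n : ℕ} (s : Finset (Fin m)) (x : Fin m → Fin n) (j : Fin m) :
    spread s x j < 3 * n := by
  have := (x j).2
  unfold spread
  split <;> omega

theorem spread_injective {m n : ℕ} (s : Finset (Fin m)) :
    Function.Injective (spread (n := n) s) := by
  intro x y h
  ext j
  have := congrFun h j
  unfold spread at this
  split at this <;> omega

/-- One coordinate is tripled in a slab of height `n + 1`. The path of `x` makes its horizontal move
at height `n - x k`, when the points with larger `k`-th coordinate have already left. -/
theorem routable_spread_insert {ι : Type*} {m n : ℕ} (a : ι → Fin m → Fin n)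
    (ha : Function.Injective a) (s : Finset (Fin m)) (k : Fin m) (hk : k ∉ s) :
    Routable (3 * n) (n + 1) (fun i => spread s (a i)) (fun i => spread (insert k s) (a i)) := by
  have hsk : ∀ x : Fin m → Fin n, spread s x k = x k := fun x => by simp [spread, hk]
  have hik : ∀ x : Fin m → Fin n, spread (insert k s) x k = 3 * x k := fun x => by simp [spread]
  have hij : ∀ (x : Fin m → Fin n) (j), j ≠ k → spread s x j = spread (insert k s) x j :=
    fun x j hj => by simp [spread, hj]
  refine ⟨fun i => {v | (∀ j, j ≠ k → v.1 j = spread s (a i) j) ∧ 0 ≤ v.2 ∧ v.2 ≤ n ∧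
    ((v.2 ≤ n - (a i k : ℕ) ∧ v.1 k = a i k) ∨
      (v.2 = n - (a i k : ℕ) ∧ a i k ≤ v.1 k ∧ v.1 k ≤ 3 * (a i k : ℕ)) ∨
      (n - (a i k : ℕ) ≤ v.2 ∧ v.1 k = 3 * (a i k : ℕ)))}, fun i i' hii => ?_, ?_, fun i => ?_⟩
  · refine Set.disjoint_left.2 ?_
    rintro ⟨y, z⟩ ⟨h1, -, -, h2⟩ ⟨h1', -, -, h2'⟩
    have hne : (a i k : ℕ) ≠ a i' k := by
      intro h
      refine hii (ha (spread_injective s ?_))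
      ext j
      by_cases hj : j = k
      · subst hj
        rw [hsk, hsk, h]
      · rw [← h1 j hj, ← h1' j hj]
    simp only at h2 h2'
    omega
  · rintro i ⟨y, z⟩ ⟨h1, h2, h3, h4⟩
    simp only at h1 h2 h3 h4 ⊢
    refine ⟨fun j => ?_, h2, by push_cast; omega⟩
    by_cases hj : j = k
    · subst hj
      have := (a i j).2
      omega
    · rw [h1 j hj]
      exact spread_lt _ _ _
  · have hn := (a i k).2
    refine ((walkWithin_vertical (q := n - (a i k : ℕ)) (by omega) ?_).trans
      (walkWithin_lateral k (hij (a i)) ?_)).trans (walkWithin_vertical (by push_cast; omega) ?_)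
    · intro z h1 h2
      exact ⟨fun j _ => rfl, h1, by simp only; omega, .inl ⟨h2, hsk _⟩⟩
    · intro w h1 h2 h3
      rw [hsk, hik] at h2 h3
      exact ⟨h1, by simp only; omega, by simp only; omega, .inr (.inl ⟨rfl, by simp only; omega,
        by simp only; omega⟩)⟩
    · intro z h1 h2
      push_cast at h2
      exact ⟨fun j hj => (hij _ j hj).symm, by simp only; omega, by simp only; omega,
        .inr (.inr ⟨h1, hik _⟩)⟩

theorem routable_spread {ι : Type*} {m n : ℕ} (a : ι → Fin m → Fin n)
    (ha : Function.Injective a) (s : Finset (Fin m)) :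
    Routable (3 * n) (1 + s.card * (n + 1)) (fun i => spread ∅ (a i))
      (fun i => spread s (a i)) := by
  induction s using Finset.induction_on with
  | empty =>
    exact .refl ((spread_injective ∅).comp ha) (fun i k => spread_lt _ _ _) (by simp)
  | insert k s hk ih =>
    rw [Finset.card_insert_of_notMem hk, add_one_mul, ← add_assoc]
    exact ih.trans (routable_spread_insert a ha s k hk)

/-- Spread-out points are permuted along the lines in direction `k`, in a slab of height `n + 1`.
The `i`-th path rises from `a i` to height `a i k`, steps into the next layer in the auxiliary
direction `l`, moves along the line there, steps into a third layer, rises to the top above `b i`,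
and only there returns to the layer it started from. -/
theorem routable_line {ι : Type*} {m n : ℕ} (a b : ι → Fin m → Fin n)
    (ha : Function.Injective a) (hb : Function.Injective b) {k l : Fin m} (hkl : l ≠ k)
    (hab : ∀ i j, j ≠ k → a i j = b i j) :
    Routable (3 * n) (n + 1) (fun i => spread .univ (a i)) (fun i => spread .univ (b i)) := by
  refine ⟨fun i => {v | (∀ j, j ≠ k → j ≠ l → v.1 j = 3 * (a i j : ℕ)) ∧ v.1 l / 3 = a i l ∧
    v.1 k < 3 * n ∧ 0 ≤ v.2 ∧ v.2 ≤ n ∧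
    ((v.1 l % 3 = 0 ∧ v.2 ≤ (a i k : ℕ) ∧ v.1 k = 3 * (a i k : ℕ)) ∨
      (v.1 l % 3 = 1 ∧ v.2 = (a i k : ℕ)) ∨
      (v.1 l % 3 = 2 ∧ (a i k : ℕ) ≤ v.2 ∧ v.1 k = 3 * (b i k : ℕ)) ∨
      (v.2 = n ∧ v.1 k = 3 * (b i k : ℕ)))}, fun i i' hii => ?_, ?_, fun i => ?_⟩
  · refine Set.disjoint_left.2 ?_
    rintro ⟨y, z⟩ ⟨h1, hl, -, -, -, h2⟩ ⟨h1', hl', -, -, -, h2'⟩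
    have hoff : ∀ j, j ≠ k → a i j = a i' j := by
      intro j hj
      by_cases hjl : j = l
      · subst hjl
        exact Fin.ext (hl.symm.trans hl')
      · have e1 := h1 j hj hjl
        have e2 := h1' j hj hjl
        exact Fin.ext (by omega)
    have hane : (a i k : ℕ) ≠ a i' k := by
      intro h
      refine hii (ha (funext fun j => ?_))
      by_cases hj : j = k
      · exact hj ▸ Fin.ext h
      · exact hoff j hj
    have hbne : (b i k : ℕ) ≠ b i' k := by
      intro h
      refine hii (hb (funext fun j => ?_))
      by_cases hj : j = k
      · exact hj ▸ Fin.ext h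
      · rw [← hab i j hj, ← hab i' j hj, hoff j hj]
    have := (a i k).2
    have := (a i' k).2
    simp only at h2 h2'
    omega
  · rintro i ⟨y, z⟩ ⟨h1, hl, hk, h2, h3, h4⟩
    simp only at h1 hl hk h2 h3 ⊢
    refine ⟨fun j => ?_, h2, by push_cast; omega⟩
    have := (a i j).2
    by_cases hj : j = k
    · exact hj ▸ hk
    · by_cases hjl : j = l
      · subst hjl
        omega
      · rw [h1 j hj hjl]
        omega
  · have hak := (a i k).2
    have hbk := (b i k).2
    -- The point of the line of `a i` with `k`-th coordinate `r`, in the layer `ε`.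
    let p : ℕ → ℕ → Fin m → ℕ := fun ε r j =>
      if j = k then r else if j = l then 3 * (a i j : ℕ) + ε else 3 * (a i j : ℕ)
    have pk : ∀ ε r, p ε r k = r := fun ε r => by simp [p]
    have pl : ∀ ε r, p ε r l = 3 * (a i l : ℕ) + ε := fun ε r => by simp [p, hkl]
    have pj : ∀ ε r j, j ≠ k → j ≠ l → p ε r j = 3 * (a i j : ℕ) :=
      fun ε r j h h' => by simp [p, h, h']
    have hpa : spread .univ (a i) = p 0 (3 * (a i k : ℕ)) := by
      ext j
      by_cases hj : j = k
      · subst hj; simp [spread, p]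
      · simp [spread, p, hj]
    have hpb : spread .univ (b i) = p 0 (3 * (b i k : ℕ)) := by
      ext j
      by_cases hj : j = k
      · subst hj; simp [spread, p]
      · simp [spread, p, hj, hab i j hj]
    have hlayer : ∀ ε ε' r j, j ≠ l → p ε r j = p ε' r j := fun ε ε' r j h => by
      simp [p, h]
    have hline : ∀ ε r r' j, j ≠ k → p ε r j = p ε r' j := fun ε r r' j h => by
      simp [p, h]
    beta_reduce
    rw [hpa, hpb]
    have hend : ((n + 1 : ℕ) : ℤ) - 1 = n := by push_cast; ring
    rw [hend]
    refine (((((walkWithin_vertical (q := (a i k : ℕ)) (by omega) ?_).trans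
      (walkWithin_lateral (v := p 1 (3 * (a i k : ℕ))) l (hlayer _ _ _) ?_)).trans
      (walkWithin_lateral (v := p 1 (3 * (b i k : ℕ))) k (hline _ _ _) ?_)).trans
      (walkWithin_lateral (v := p 2 (3 * (b i k : ℕ))) l (hlayer _ _ _) ?_)).trans
      (walkWithin_vertical (q := n) (by omega) ?_)).trans
      (walkWithin_lateral l (hlayer _ _ _) ?_)
    · intro z h1 h2
      refine ⟨pj _ _, ?_, ?_, ?_, ?_, ?_⟩ <;> simp only [pk, pl] <;> first | omega | grind
    · intro w h1 h2 h3
      rw [pl, pl] at h2 h3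
      have hwk := h1 k hkl.symm
      rw [pk] at hwk
      refine ⟨fun j hj hjl => (h1 j hjl).trans (pj _ _ j hj hjl), ?_, ?_, ?_, ?_, ?_⟩ <;>
        simp only <;> first | omega | grind
    · intro w h1 h2 h3
      rw [pk, pk] at h2 h3
      have hwl := h1 l hkl
      rw [pl] at hwl
      refine ⟨fun j hj hjl => (h1 j hj).trans (pj _ _ j hj hjl), ?_, ?_, ?_, ?_, ?_⟩ <;>
        simp only <;> first | omega | grind
    · intro w h1 h2 h3
      rw [pl, pl] at h2 h3
      have hwk := h1 k hkl.symm
      rw [pk] at hwk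
      refine ⟨fun j hj hjl => (h1 j hjl).trans (pj _ _ j hj hjl), ?_, ?_, ?_, ?_, ?_⟩ <;>
        simp only <;> first | omega | grind
    · intro z h1 h2
      refine ⟨pj _ _, ?_, ?_, ?_, ?_, ?_⟩ <;> simp only [pk, pl] <;> first | omega | grind
    · intro w h1 h2 h3
      rw [pl, pl] at h2 h3
      have hwk := h1 k hkl.symm
      rw [pk] at hwk
      refine ⟨fun j hj hjl => (h1 j hjl).trans (pj _ _ j hj hjl), ?_, ?_, ?_, ?_, ?_⟩ <;>
        simp only <;> first | omega | grind

/-! ### Routing arbitrary partial injections -/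

/-- Points whose coordinates outside `s` are kept can be permuted arbitrarily. For `k ∈ s`, an edge
colouring chooses intermediate `k`-th coordinates, so that the permutation becomes one along
direction `k`, one in the directions `s \ {k}`, and another one along `k`. -/
theorem routable_spread_univ {ι : Type*} {m n : ℕ} (hm : 2 ≤ m) (s : Finset (Fin m))
    (a b : ι → Fin m → Fin n) (ha : Function.Injective a) (hb : Function.Injective b)
    (hab : ∀ i, ∀ j ∉ s, a i j = b i j) :
    Routable (3 * n) (1 + s.card * (2 * (n + 1))) (fun i => spread .univ (a i))
      (fun i => spread .univ (b i)) := by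
  induction s using Finset.induction_on generalizing a b with
  | empty =>
    have : a = b := funext fun i => funext fun j => hab i j (by simp)
    subst this
    exact .refl ((spread_injective _).comp ha) (fun i k => spread_lt _ _ _) (by simp)
  | insert k s hk ih =>
    let off : (Fin m → Fin n) → ({j // j ≠ k} → Fin n) := fun x j => x j
    have hoff : ∀ x y, off x = off y → x k = y k → x = y := by
      intro x y h hxy
      funext j
      by_cases hj : j = k
      · exact hj ▸ hxy
      · exact congrFun h ⟨j, hj⟩
    obtain ⟨κ, hκa, hκb⟩ := exists_edge_coloring (fun i => (off (a i), a i k))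
      (fun i => (off (b i), b i k))
      (fun i i' h => ha (hoff _ _ (congrArg Prod.fst h) (congrArg Prod.snd h)))
      (fun i i' h => hb (hoff _ _ (congrArg Prod.fst h) (congrArg Prod.snd h)))
    have hinj : ∀ c : ι → Fin m → Fin n, Function.Injective (fun i => (off (c i), κ i)) →
        Function.Injective (fun i => Function.update (c i) k (κ i)) := by
      intro c hc i i' h
      refine hc (Prod.ext (funext fun j => ?_) ?_)
      · simpa [j.2] using congrFun h j
      · simpa using congrFun h k
    obtain ⟨l, hl⟩ : ∃ l, l ≠ k := by
      have : Nontrivial (Fin m) := Fin.nontrivial_iff_two_le.2 hm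
      exact exists_ne k
    have h1 := routable_line a _ ha (hinj a hκa) hl (fun i j hj => by simp [hj])
    have h2 := ih _ _ (hinj a hκa) (hinj b hκb) fun i j hj => by
      by_cases hjk : j = k
      · subst hjk; simp
      · simpa [hjk] using hab i j (by simp [hj, hjk])
    have h3 := routable_line _ b (hinj b hκb) hb hl (fun i j hj => by simp [hj])
    have h := (h1.trans h2).trans h3
    rw [Finset.card_insert_of_notMem hk]
    convert h using 1
    ring

/-- Any partial injection of `[n]^m` can be routed: spread out, permute, contract. -/
theorem routable_of_injective {ι : Type*} {m n h : ℕ} (hm : 2 ≤ m)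
    (a b : ι → Fin m → Fin n) (ha : Function.Injective a) (hb : Function.Injective b)
    (hh : 4 * m * (n + 1) + 4 ≤ h) :
    Routable (3 * n) h (fun i j => (a i j : ℕ)) (fun i j => (b i j : ℕ)) := by
  have h0 : ∀ x : Fin m → Fin n, spread ∅ x = fun j => (x j : ℕ) := fun x => by
    ext j; simp [spread]
  have h1 := routable_spread a ha Finset.univ
  have h2 := routable_spread_univ hm .univ a b ha hb (by simp)
  have h3 := (routable_spread b hb Finset.univ).symm
  have h4 : Routable (3 * n) (h - (4 * m * (n + 1) + 3)) (fun i => spread ∅ (b i)) _ :=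
    .refl ((spread_injective ∅).comp hb) (fun i k => spread_lt _ _ _) (by omega)
  have H := ((h1.trans h2).trans h3).trans h4
  simp only [h0, Finset.card_univ, Fintype.card_fin] at H
  convert H using 1
  have : 1 + m * (n + 1) + (1 + m * (2 * (n + 1))) + (1 + m * (n + 1)) = 4 * m * (n + 1) + 3 := by
    ring
  omega

/-- A demand multigraph on `[n]^m` with at most `t` edges at each vertex is routed with `t` colours
so that walks of the same colour are disjoint. -/
theorem exists_colored_routing {ι : Type*} {m n t h : ℕ} (hm : 2 ≤ m)
    (a b : ι → (Fin m → Fin n) × Fin t) (ha : Function.Injective a) (hb : Function.Injective b)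
    (hh : 4 * m * (n + 1) + 4 ≤ h) :
    ∃ (κ : ι → Fin t) (S : ι → Set ((Fin m → ℕ) × ℤ)),
      (∀ i i', i ≠ i' → κ i = κ i' → Disjoint (S i) (S i')) ∧
      (∀ i, ∀ v ∈ S i, (∀ k, v.1 k < 3 * n) ∧ 0 ≤ v.2 ∧ v.2 < h) ∧
      ∀ i, WalkWithin (slabGrid m) (S i) (fun j => ((a i).1 j : ℕ), 0)
        (fun j => ((b i).1 j : ℕ), (h : ℤ) - 1) := by
  obtain ⟨κ, hκa, hκb⟩ := exists_edge_coloring a b ha hb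
  have key : ∀ c : Fin t, Routable (3 * n) h (fun (i : {i // κ i = c}) j => ((a i).1 j : ℕ))
      (fun i j => ((b i).1 j : ℕ)) := fun c =>
    routable_of_injective hm (fun i : {i // κ i = c} => (a i).1) (fun i => (b i).1)
      (fun i i' hi => Subtype.ext (hκa (Prod.ext hi (i.2.trans i'.2.symm))))
      (fun i i' hi => Subtype.ext (hκb (Prod.ext hi (i.2.trans i'.2.symm)))) hh
  choose S hS hbd hw using key
  refine ⟨κ, fun i => S (κ i) ⟨i, rfl⟩, fun i i' hne hκ => ?_, fun i => hbd _ _, fun i => hw _ _⟩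
  have : ∀ c (hc : κ i' = c), S (κ i') ⟨i', rfl⟩ = S c ⟨i', hc⟩ := by
    rintro c rfl
    rfl
  beta_reduce
  rw [this _ hκ.symm]
  exact hS _ fun h => hne (congrArg Subtype.val h)

/-! ### Placing the slab into the cube -/

theorem euclideanCube_adj {d n : ℕ} {x y : Fin d → Seg n} (k : Fin d) (h : ∀ j, j ≠ k → x j = y j)
    (hk : (x k : ℕ) + 1 = y k) : (euclideanCube d n).Adj x y := by
  change dist (gridPoint x) (gridPoint y) = 1
  rw [EuclideanSpace.dist_eq, Finset.sum_eq_single k]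
  · have : ((y k : ℕ) : ℝ) = (x k : ℕ) + 1 := by rw [← hk]; push_cast; rfl
    simp [gridPoint, this]
  · intro j _ hj
    simp [gridPoint, h j hj]
  · simp

/-- The point of the cube `[N]^(m + 1)` in which the vertex `v` of the slab is placed: coordinates
are shifted to start at `1`, and heights so that the height `-1` goes to the bottom layer.
Coordinates leaving the cube are clamped. -/
def slabCell {m : ℕ} (N : ℕ) (hN : 0 < N) (v : (Fin m → ℕ) × ℤ) : Fin (m + 1) → Seg N := fun k =>
  ⟨max 1 (min (if h : (k : ℕ) < m then v.1 ⟨k, h⟩ + 1 else (v.2 + 2).toNat) N), by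
    rw [Set.mem_Icc]; omega⟩

/-- The vertices of the slab that are placed without clamping. -/
def slabRegion (m N : ℕ) : Set ((Fin m → ℕ) × ℤ) :=
  {v | (∀ k, v.1 k < N) ∧ -1 ≤ v.2 ∧ v.2 + 2 ≤ N}

section slabCell

variable {m N : ℕ} {hN : 0 < N} {u v : (Fin m → ℕ) × ℤ}

theorem slabCell_castSucc (hv : v ∈ slabRegion m N) (k : Fin m) :
    (slabCell N hN v k.castSucc : ℕ) = v.1 k + 1 := by
  have := hv.1 k
  simp [slabCell]
  omega

theorem slabCell_last (hv : v ∈ slabRegion m N) :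
    ((slabCell N hN v (Fin.last m) : ℕ) : ℤ) = v.2 + 2 := by
  have := hv.2
  simp [slabCell]
  omega

theorem slabCell_eq (hv : v ∈ slabRegion m N) {x : Fin (m + 1) → Seg N}
    (hx : ∀ k : Fin m, (x k.castSucc : ℕ) = v.1 k + 1)
    (hx' : ((x (Fin.last m) : ℕ) : ℤ) = v.2 + 2) : slabCell N hN v = x := by
  funext k
  refine Subtype.ext ?_
  induction k using Fin.lastCases with
  | last =>
    have := slabCell_last (hN := hN) hv
    omega
  | cast k => rw [slabCell_castSucc hv, hx]

theorem slabCell_injOn : Set.InjOn (slabCell (m := m) N hN) (slabRegion m N) := by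
  intro u hu v hv h
  refine Prod.ext (funext fun k => ?_) ?_
  · have h1 := slabCell_castSucc (hN := hN) hu k
    rw [h, slabCell_castSucc hv] at h1
    omega
  · have h1 := slabCell_last (hN := hN) hu
    rw [h, slabCell_last hv] at h1
    omega

theorem slabCell_adj (hu : u ∈ slabRegion m N) (hv : v ∈ slabRegion m N)
    (h : (slabGrid m).Adj u v) :
    (euclideanCube (m + 1) N).Adj (slabCell N hN u) (slabCell N hN v) := by
  have vert : ∀ {u v}, u ∈ slabRegion m N → v ∈ slabRegion m N → u.1 = v.1 → u.2 + 1 = v.2 →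
      (euclideanCube (m + 1) N).Adj (slabCell N hN u) (slabCell N hN v) := by
    intro u v hu hv h1 h2
    refine euclideanCube_adj (Fin.last m) (fun j hj => ?_) ?_
    · induction j using Fin.lastCases with
      | last => exact absurd rfl hj
      | cast k => exact Subtype.ext (by rw [slabCell_castSucc hu, slabCell_castSucc hv, h1])
    · have := slabCell_last (hN := hN) hu
      have := slabCell_last (hN := hN) hv
      omega
  have lat : ∀ {u v} (k : Fin m), u ∈ slabRegion m N → v ∈ slabRegion m N → u.2 = v.2 →
      (∀ j, j ≠ k → u.1 j = v.1 j) → u.1 k + 1 = v.1 k →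
      (euclideanCube (m + 1) N).Adj (slabCell N hN u) (slabCell N hN v) := by
    intro u v k hu hv h1 h2 h3
    refine euclideanCube_adj k.castSucc (fun j hj => Subtype.ext ?_) ?_
    · induction j using Fin.lastCases with
      | last =>
        have := slabCell_last (hN := hN) hu
        have := slabCell_last (hN := hN) hv
        omega
      | cast j =>
        rw [slabCell_castSucc hu, slabCell_castSucc hv, h2 j fun h => hj (congrArg _ h)]
    · rw [slabCell_castSucc hu, slabCell_castSucc hv, h3]
  rcases h with ⟨h1, h2 | h2⟩ | ⟨h1, k, h2, h3 | h3⟩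
  · exact vert hu hv h1 h2
  · exact (vert hv hu h1.symm h2).symm
  · exact lat k hu hv h1 h2 h3
  · exact (lat k hv hu h1.symm (fun j hj => (h2 j hj).symm) h3).symm

end slabCell

/-- Moving to an adjacent cell may be combined with any change of the label. -/
theorem blownUpCube_adj {d n t : ℕ} {x y : Fin d → Seg n} (h : (euclideanCube d n).Adj x y)
    (i j : Seg t) : (blownUpCube d n t).Adj (x, i) (y, j) :=
  ⟨fun e => h.ne (congrArg Prod.fst e), .inr h⟩

section layerPoint

variable {m N t n z : ℕ} {x y : (Fin (m + 1) → Seg N) × Seg t}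

theorem le_of_mem_blownUpLayer (hx : x ∈ blownUpLayer (m + 1) N t n z) (k : Fin m) :
    1 ≤ (x.1 k.castSucc : ℕ) ∧ (x.1 k.castSucc : ℕ) ≤ n :=
  ⟨(x.1 k.castSucc).2.1, (hx k.castSucc).1 (by simp)⟩

theorem last_of_mem_blownUpLayer (hx : x ∈ blownUpLayer (m + 1) N t n z) :
    (x.1 (Fin.last m) : ℕ) = z :=
  (hx (Fin.last m)).2 (by simp)

/-- A vertex of a layer as an element of `[n]^m × [t]`, with all coordinates counted from `0`. -/
def layerPoint (x : (Fin (m + 1) → Seg N) × Seg t) (hx : x ∈ blownUpLayer (m + 1) N t n z) :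
    (Fin m → Fin n) × Fin t :=
  (fun k => ⟨(x.1 k.castSucc : ℕ) - 1, by have := le_of_mem_blownUpLayer hx k; omega⟩,
    ⟨(x.2 : ℕ) - 1, by have := x.2.2; rw [Set.mem_Icc] at this; omega⟩)

theorem layerPoint_inj (hx : x ∈ blownUpLayer (m + 1) N t n z)
    (hy : y ∈ blownUpLayer (m + 1) N t n z) (hxy : layerPoint x hx = layerPoint y hy) :
    x = y := by
  simp only [layerPoint, Prod.mk.injEq, Fin.mk.injEq] at hxy
  refine Prod.ext (funext fun k => Subtype.ext ?_) (Subtype.ext ?_)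
  · induction k using Fin.lastCases with
    | last => rw [last_of_mem_blownUpLayer hx, last_of_mem_blownUpLayer hy]
    | cast k =>
      have h1 := congrArg Fin.val (congrFun hxy.1 k)
      have := le_of_mem_blownUpLayer hx k
      have := le_of_mem_blownUpLayer hy k
      simp only at h1
      omega
  · have h1 := x.2.2
    have h2 := y.2.2
    rw [Set.mem_Icc] at h1 h2
    omega

/-- A vertex `x` of a layer is adjacent to all vertices of the cell directly above or below it. -/
theorem blownUpCube_adj_slabCell {hN : 0 < N} (hnN : n ≤ N)
    (hx : x ∈ blownUpLayer (m + 1) N t n z) {w : ℤ} (hw : -1 ≤ w) (hwN : w + 2 ≤ N)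
    (hwz : w + 2 + 1 = z ∨ (z : ℤ) + 1 = w + 2) (i : Seg t) :
    (blownUpCube (m + 1) N t).Adj x
      (slabCell N hN (fun j => ((layerPoint x hx).1 j : ℕ), w), i) := by
  have hr : ∀ w : ℤ, -1 ≤ w → w + 2 ≤ N →
      ((fun j => ((layerPoint x hx).1 j : ℕ), w) : (Fin m → ℕ) × ℤ) ∈ slabRegion m N :=
    fun w h2 h3 => ⟨fun k => ((layerPoint x hx).1 k).2.trans_le hnN, h2, h3⟩
  have hz := (x.1 (Fin.last m)).2
  rw [last_of_mem_blownUpLayer hx, Set.mem_Icc] at hz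
  have hxr := hr (z - 2) (by omega) (by omega)
  have hcell : slabCell N hN (fun j => ((layerPoint x hx).1 j : ℕ), (z : ℤ) - 2) = x.1 := by
    refine slabCell_eq hxr (fun k => ?_) ?_
    · have := le_of_mem_blownUpLayer hx k
      simp only [layerPoint]
      omega
    · rw [last_of_mem_blownUpLayer hx]
      ring
  have := slabCell_adj (hN := hN) hxr (hr w hw hwN) (.inl ⟨rfl, by simp only; omega⟩)
  rw [hcell] at this
  exact blownUpCube_adj this x.2 i

end layerPoint

theorem mainTheorem5 (d : ℕ) (hd : 3 ≤ d) :
    ∃ c : ℕ, 0 < c ∧ ∀ n t : ℕ, 0 < n → 0 < t →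
      ∀ M : ((⊤ : SimpleGraph ((Fin d → Seg (c * n)) × Seg t)).between
          (blownUpLayer d (c * n) t n 1) (blownUpLayer d (c * n) t n (c * n))).Subgraph,
        M.IsMatching →
          EmbedsByDisjointPaths (blownUpCube d (c * n) t)
            (blownUpLayer d (c * n) t n 1) (blownUpLayer d (c * n) t n (c * n)) M := by
  obtain ⟨m, rfl⟩ : ∃ m, d = m + 1 := ⟨d - 1, by omega⟩
  -- The routing needs `4 * m * (n + 1) + 4` layers besides the bottom and the top one.
  refine ⟨8 * m + 6, by omega, fun n t hn ht M hM => ?_⟩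
  obtain ⟨h, hN, hh⟩ : ∃ h, (8 * m + 6) * n = h + 2 ∧ 4 * m * (n + 1) + 4 ≤ h := by
    have : m ≤ m * n := Nat.le_mul_of_pos_right m hn
    refine ⟨(8 * m + 6) * n - 2, ?_, ?_⟩ <;> ring_nf <;> omega
  have h3n : 3 * n ≤ h + 2 := hN ▸ Nat.mul_le_mul_right n (by omega)
  generalize (8 * m + 6) * n = N at M hM hN
  subst hN
  have hN : 0 < h + 2 := by omega
  let D := {e : ((Fin (m + 1) → Seg (h + 2)) × Seg t) × ((Fin (m + 1) → Seg (h + 2)) × Seg t) //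
    e.1 ∈ blownUpLayer (m + 1) (h + 2) t n 1 ∧ e.2 ∈ blownUpLayer (m + 1) (h + 2) t n (h + 2) ∧
    M.Adj e.1 e.2}
  have huniq : ∀ {p q q'}, M.Adj p q → M.Adj p q' → q = q' := fun h1 h2 =>
    (hM h1.fst_mem).unique h1 h2
  have hpD : Function.Injective fun e : D => e.1.1 := fun e e' he =>
    Subtype.ext (Prod.ext he (huniq e.2.2.2 (by rw [show e.1.1 = e'.1.1 from he]; exact e'.2.2.2)))
  have hqD : Function.Injective fun e : D => e.1.2 := fun e e' he =>
    Subtype.ext (Prod.ext (huniq e.2.2.2.symm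
      (by rw [show e.1.2 = e'.1.2 from he]; exact e'.2.2.2.symm)) he)
  obtain ⟨κ, S, hS, hbd, hw⟩ := exists_colored_routing (m := m) (by omega)
    (fun e : D => layerPoint e.1.1 e.2.1) (fun e : D => layerPoint e.1.2 e.2.2.1)
    (fun e e' he => hpD (layerPoint_inj e.2.1 e'.2.1 he))
    (fun e e' he => hqD (layerPoint_inj e.2.2.1 e'.2.2.1 he)) hh
  have hreg : ∀ e : D, ∀ v ∈ S e, v ∈ slabRegion m (h + 2) := by
    intro e v hv
    obtain ⟨h1, h2, h3⟩ := hbd e v hv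
    exact ⟨fun k => by have := h1 k; omega, by omega, by push_cast; omega⟩
  let lab' : Fin t → Seg t := fun i => ⟨i + 1, by rw [Set.mem_Icc]; omega⟩
  have hlab' : Function.Injective lab' := fun i j hij => by
    have := congrArg Subtype.val hij
    simp only [lab'] at this
    omega
  -- The route of `e` keeps the label given by its colour, except at the two ends.
  let T : D → Set ((Fin (m + 1) → Seg (h + 2)) × Seg t) := fun e =>
    {e.1.1, e.1.2} ∪ (fun v => (slabCell (h + 2) hN v, lab' (κ e))) '' S e
  have hT : ∀ e : D, WalkWithin (blownUpCube (m + 1) (h + 2) t) (T e) e.1.1 e.1.2 := by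
    intro e
    have hmid := (hw e).map (H := blownUpCube (m + 1) (h + 2) t) (U := T e)
      (fun v => (slabCell (h + 2) hN v, lab' (κ e))) (fun v hv => .inr ⟨v, hv, rfl⟩)
      (fun u hu v hv huv => blownUpCube_adj (slabCell_adj (hreg e u hu) (hreg e v hv) huv) _ _)
    obtain ⟨r, hr⟩ := hmid
    have hp := blownUpCube_adj_slabCell (hN := hN) (by omega) e.2.1 (w := 0) (by omega) (by simp)
      (.inr (by norm_num)) (lab' (κ e))
    have hq := blownUpCube_adj_slabCell (hN := hN) (by omega) e.2.2.1 (w := h - 1) (by omega)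
      (by push_cast; omega) (.inl (by push_cast; ring)) (lab' (κ e))
    exact ((WalkWithin.of_adj hp (.inl (.inl rfl)) (hr _ r.start_mem_support)).trans ⟨r, hr⟩).trans
      (WalkWithin.of_adj hq (.inl (.inr rfl)) (hr _ r.end_mem_support)).symm
  have hmidlast : ∀ (e : D) v, v ∈ S e → 1 < (slabCell (h + 2) hN v (Fin.last m) : ℕ) ∧
      (slabCell (h + 2) hN v (Fin.last m) : ℕ) < h + 2 := by
    intro e v hv
    have h1 := slabCell_last (hN := hN) (hreg e v hv)
    have h2 := (hbd e v hv).2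
    omega
  have hdisj : ∀ e e' : D, e ≠ e' → ∀ x, x ∈ T e → x ∉ T e' := by
    have hP : ∀ e : D, (e.1.1.1 (Fin.last m) : ℕ) = 1 := fun e => last_of_mem_blownUpLayer e.2.1
    have hQ : ∀ e : D, (e.1.2.1 (Fin.last m) : ℕ) = h + 2 := fun e =>
      last_of_mem_blownUpLayer e.2.2.1
    rintro e e' hne x ((hx | hx) | ⟨v, hv, hx⟩) ((hx' | hx') | ⟨v', hv', hx'⟩)
    · exact hne (hpD (hx.symm.trans hx'))
    · have h1 := hP e
      rw [← hx, hx', hQ] at h1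
      omega
    · have h1 := hP e
      rw [← hx, ← hx'] at h1
      have := hmidlast e' v' hv'
      simp only at h1
      omega
    · have h1 := hQ e
      rw [← hx, hx', hP] at h1
      omega
    · exact hne (hqD (hx.symm.trans hx'))
    · have h1 := hQ e
      rw [← hx, ← hx'] at h1
      have := hmidlast e' v' hv'
      simp only at h1
      omega
    · have h1 := hP e'
      rw [← hx', ← hx] at h1
      have := hmidlast e v hv
      simp only at h1
      omega
    · have h1 := hQ e'
      rw [← hx', ← hx] at h1
      have := hmidlast e v hv
      simp only at h1
      omega
    · have hvv := hx.trans hx'.symm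
      simp only [Prod.mk.injEq] at hvv
      have := slabCell_injOn (hreg e v hv) (hreg e' v' hv') hvv.1
      subst this
      exact Set.disjoint_left.1 (hS e e' hne (hlab' hvv.2)) hv hv'
  classical
  choose w hwT using hT
  exact ⟨fun e => (w e).toPath, fun e e' hne x hx hx' => hdisj e e' hne x
    (hwT e x ((w e).support_toPath_subset_support hx))
    (hwT e' x ((w e').support_toPath_subset_support hx'))⟩
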